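/- A (simple) $t$-$(v,k,\lambda)$ design $\mathcal{D}$ is a set $X$ of $v$ points together with a set of $k$-element subsets of $X$, called blocks, such that every $t$-element subset of $X$ is contained in exactly $\lambda$ blocks. It is called self-orthogonal if $|B\cap B'|\equiv k \pmod 2$ for any two distinct blocks $B, B'$. Let $C(\mathcal{D})\subseteq \mathbb{F}_2^{X}$ be the binary code generated by the rows of the block-point incidence matrix of $\mathcal{D}$, and for a code $C\subseteq\mathbb{F}_2^X$ let $C^\perp$ be its dual with respect to the standard inner product. **Proposition 3.2.** Let $\mathcal{D}$ be a self-orthogonal $5$-$(v,k,\lambda)$ design, where $(v,k,\lambda)$ is one of $$(120,36,37237713920),\quad (120,40,1372275835848),\quad (120,44,26386953577600),$$ $$(120,48,274320081834480),\quad (144,56,283096123959568608).$$ Then $C(\mathcal{D})$ is self-dual, that is, $C(\mathcal{D})=C(\mathcal{D})^\perp$. -/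

import Mathlib

namespace SelfDualDesign

/-- `IsDesign X t v k lam blocks`: the set `blocks` of subsets of the finite point set `X` is a
(simple) `t`-`(v, k, lam)` design. There are `v` points, each block has `k` points, and each
`t`-subset of points lies in exactly `lam` blocks. Blocks form a set, so none is repeated. -/
structure IsDesign (X : Type*) [Fintype X] [DecidableEq X] (t v k lam : ℕ)
    (blocks : Finset (Finset X)) : Prop where
  card_points : Fintype.card X = v
  card_block : ∀ b ∈ blocks, b.card = k
  card_through : ∀ T : Finset X, T.card = t → (blocks.filter fun b => T ⊆ b).card = lam

/-- A design with block size `k` is self-orthogonal if any two distinct blocks meet in a number of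
points that has the same parity as `k`. -/
def IsSelfOrthogonal {X : Type*} [DecidableEq X] (k : ℕ) (blocks : Finset (Finset X)) : Prop :=
  ∀ b₁ ∈ blocks, ∀ b₂ ∈ blocks, b₁ ≠ b₂ → (b₁ ∩ b₂).card ≡ k [MOD 2]

/-- The block-point incidence matrix, over the field with two elements. -/
def incidenceMatrix {X : Type*} [DecidableEq X] (blocks : Finset (Finset X)) :
    Matrix blocks X (ZMod 2) :=
  Matrix.of fun b x => if x ∈ b.1 then 1 else 0

/-- The binary code generated by the rows of the incidence matrix. -/
def code {X : Type*} [DecidableEq X] (blocks : Finset (Finset X)) :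
    Submodule (ZMod 2) (X → ZMod 2) :=
  Submodule.span (ZMod 2) (Set.range (incidenceMatrix blocks).row)

/-- The dual of a binary code under the standard inner product. -/
def dualCode {X : Type*} [Fintype X] (C : Submodule (ZMod 2) (X → ZMod 2)) :
    Submodule (ZMod 2) (X → ZMod 2) where
  carrier := {y | ∀ x ∈ C, x ⬝ᵥ y = 0}
  zero_mem' := fun x _ => dotProduct_zero x
  add_mem' := fun {y z} hy hz x hx => by rw [dotProduct_add, hy x hx, hz x hx, add_zero]
  smul_mem' := fun c y hy x hx => by rw [dotProduct_smul, hy x hx, smul_zero]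

/-- A binary code is self-dual if it equals its dual. -/
def IsSelfDual {X : Type*} [Fintype X] (C : Submodule (ZMod 2) (X → ZMod 2)) : Prop :=
  C = dualCode C

end SelfDualDesign

open Finset

/-! ### Designs: intersection moments and blocks meeting a set evenly. -/

namespace SelfDualDesign

/-! Let `C` be the code and `n` its length. As `4 ∣ k` and blocks meet evenly, `C` is
self-orthogonal and doubly even. A dual word with support `S` meets every block evenly. The sum over
blocks of p(|b ∩ S|), p(x) = x(x-2)(x-4)(x-6)(x-8), depends only on |S| because p has degree 5
(`sum_evenVanishing`). It is a multiple of 3840 by evenness, which rules out odd |S|; it is 0 if |S|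
≤ 8, which rules out 2, 4, 6, 8. Hence the all-one word lies in `C`.

If `C` were not self-dual, then |C| ≤ 2^d with d = n/2 - 1. Take f = f₀ + ∑ f_j K_j with Krawtchouk
polynomials K_j. By MacWilliams (`sum_krawtchouk`), the sum of f over the weights of `C` is |C| (f₀
+ ∑ f_j B_j), where B_j counts dual words of weight j; it is at most 2^d f₀ if f_j ≤ 0 except at j =
2, 4, 6, 8. Below, the sum is bounded using the words of weight 0 and n, the blocks and their
complements. An explicit f for each parameter set makes the bounds contradict. -/

/-- The value at `j` of `x (x - 2) (x - 4) (x - 6) (x - 8)`, in the binomial basis. -/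
def evenVanishing (j : ℕ) : ℤ :=
  105 * j.choose 1 - 210 * j.choose 2 + 270 * j.choose 3 - 240 * j.choose 4 + 120 * j.choose 5

/-- 2s(2s-2)(2s-4)(2s-6)(2s-8) = 2⁵ · 5! · C(s,5). -/
theorem evenVanishing_two_mul (s : ℕ) : evenVanishing (2 * s) = 3840 * s.choose 5 := by
  rcases lt_or_ge s 5 with hs | hs
  · interval_cases s <;> decide
  obtain ⟨m, rfl⟩ := Nat.exists_eq_add_of_le' hs
  have key (n i : ℕ) : (n.descFactorial i : ℤ) = i.factorial * n.choose i :=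
    mod_cast Nat.descFactorial_eq_factorial_mul_choose n i
  -- Writing 2s as n + 5 removes truncated subtraction from the falling factorials.
  obtain ⟨n, hn⟩ : ∃ n, 2 * (m + 5) = n + 5 := ⟨2 * m + 5, by ring⟩
  have hn' : (n : ℤ) = 2 * m + 5 := by omega
  have h1 := key (n + 5) 1
  have h2 := key (n + 5) 2
  have h3 := key (n + 5) 3
  have h4 := key (n + 5) 4
  have h5 := key (n + 5) 5
  have h6 := key (m + 5) 5
  simp only [Nat.descFactorial_succ, Nat.descFactorial_zero, Nat.factorial] at h1 h2 h3 h4 h5 h6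
  simp only [Nat.sub_zero, show n + 5 - 1 = n + 4 by omega,
    show n + 5 - 2 = n + 3 by omega, show n + 5 - 3 = n + 2 by omega,
    show n + 5 - 4 = n + 1 by omega, show m + 5 - 1 = m + 4 by omega,
    show m + 5 - 2 = m + 3 by omega, show m + 5 - 3 = m + 2 by omega,
    show m + 5 - 4 = m + 1 by omega] at h1 h2 h3 h4 h5 h6
  push_cast [hn'] at h1 h2 h3 h4 h5 h6
  rw [evenVanishing, hn]
  linear_combination -105 * h1 + 105 * h2 - 45 * h3 + 10 * h4 - h5 + 32 * h6

theorem dvd_sum_evenVanishing {X : Type*} [DecidableEq X] {blocks : Finset (Finset X)}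
    {S : Finset X} (h : ∀ b ∈ blocks, Even #(b ∩ S)) :
    (3840 : ℤ) ∣ ∑ b ∈ blocks, evenVanishing #(b ∩ S) := by
  refine dvd_sum fun b hb => ?_
  obtain ⟨s, hs⟩ := (h b hb).two_dvd
  rw [hs, evenVanishing_two_mul]
  exact dvd_mul_right _ _

/-- All intersection sizes are among the roots 0, 2, 4, 6, 8. -/
theorem sum_evenVanishing_eq_zero {X : Type*} [DecidableEq X] {blocks : Finset (Finset X)}
    {S : Finset X} (h : ∀ b ∈ blocks, Even #(b ∩ S)) (hS : #S ≤ 8) :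
    ∑ b ∈ blocks, evenVanishing #(b ∩ S) = 0 := by
  refine sum_eq_zero fun b hb => ?_
  obtain ⟨s, hs⟩ := (h b hb).two_dvd
  have : #(b ∩ S) ≤ #S := card_le_card inter_subset_right
  rw [hs, evenVanishing_two_mul, Nat.choose_eq_zero_of_lt (by omega)]
  rfl

variable {X : Type*} [Fintype X] [DecidableEq X]

/-- A `(t + 1)`-design is a `t`-design. -/
theorem IsDesign.of_succ {t v k lam mu : ℕ} {blocks : Finset (Finset X)}
    (h : IsDesign X (t + 1) v k lam blocks) (htk : t < k) (hmu : lam * (v - t) = mu * (k - t)) :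
    IsDesign X t v k mu blocks where
  card_points := h.card_points
  card_block := h.card_block
  card_through T hT := by
    -- Count pairs (x, b) with x ∉ T and T ∪ {x} ⊆ b in two ways.
    have hcount : ∑ x ∈ Tᶜ, #{b ∈ blocks | insert x T ⊆ b} =
        ∑ b ∈ blocks with T ⊆ b, #{x ∈ Tᶜ | x ∈ b} := by
      simp only [card_filter, sum_filter]
      rw [sum_comm]
      refine sum_congr rfl fun b _ => ?_
      by_cases hb : T ⊆ b <;> simp [insert_subset_iff, hb]
    have hleft : ∑ x ∈ Tᶜ, #{b ∈ blocks | insert x T ⊆ b} = (v - t) * lam := by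
      rw [sum_congr rfl fun x hx => h.card_through (insert x T) ?_, sum_const, card_compl,
        h.card_points, hT, smul_eq_mul]
      rw [card_insert_of_notMem (mem_compl.1 hx), hT]
    have hright : ∑ b ∈ blocks with T ⊆ b, #{x ∈ Tᶜ | x ∈ b} =
        #{b ∈ blocks | T ⊆ b} * (k - t) := by
      rw [sum_congr rfl fun b hb => ?_, sum_const, smul_eq_mul]
      obtain ⟨hb, hTb⟩ := mem_filter.1 hb
      have : {x ∈ Tᶜ | x ∈ b} = b \ T := by ext; simp [and_comm]
      rw [this, card_sdiff_of_subset hTb, h.card_block b hb, hT]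
    rw [hleft, hright, mul_comm, hmu] at hcount
    exact (Nat.eq_of_mul_eq_mul_right (by omega) hcount).symm

/-- In a `t`-design every point set has the intersection moments of the parameters. -/
theorem IsDesign.sum_choose_card_inter {t v k lam : ℕ} {blocks : Finset (Finset X)}
    (h : IsDesign X t v k lam blocks) (S : Finset X) :
    ∑ b ∈ blocks, (#(b ∩ S)).choose t = lam * (#S).choose t := by
  -- Count pairs (T, b) with T a t-subset of b ∩ S.
  have hb (b : Finset X) : (#(b ∩ S)).choose t = ∑ T ∈ S.powersetCard t, if T ⊆ b then 1 else 0 := by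
    rw [← card_powersetCard, ← card_filter]
    congr 1
    ext T
    simp only [mem_powersetCard, mem_filter, subset_inter_iff]
    tauto
  simp only [hb]
  rw [sum_comm, sum_congr rfl fun T hT => ?_, sum_const, card_powersetCard, smul_eq_mul, mul_comm]
  rw [← card_filter, h.card_through T (mem_powersetCard.1 hT).2]

/-- The sum of `evenVanishing #(b ∩ S)` over the blocks `b` of a `5`-design, for `#S = w`, in terms
of the numbers of blocks through `1, …, 5` points, with the binomial coefficients written so that
they are computed quickly. -/
def evenMoment (l₁ l₂ l₃ l₄ l₅ w : ℕ) : ℤ :=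
  105 * (l₁ * (w.descFactorial 1 / Nat.factorial 1) : ℕ) -
    210 * (l₂ * (w.descFactorial 2 / Nat.factorial 2) : ℕ) +
    270 * (l₃ * (w.descFactorial 3 / Nat.factorial 3) : ℕ) -
    240 * (l₄ * (w.descFactorial 4 / Nat.factorial 4) : ℕ) +
    120 * (l₅ * (w.descFactorial 5 / Nat.factorial 5) : ℕ)

theorem sum_evenVanishing {v k l₁ l₂ l₃ l₄ l₅ : ℕ} {blocks : Finset (Finset X)}
    (h₁ : IsDesign X 1 v k l₁ blocks) (h₂ : IsDesign X 2 v k l₂ blocks)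
    (h₃ : IsDesign X 3 v k l₃ blocks) (h₄ : IsDesign X 4 v k l₄ blocks)
    (h₅ : IsDesign X 5 v k l₅ blocks) (S : Finset X) :
    ∑ b ∈ blocks, evenVanishing #(b ∩ S) = evenMoment l₁ l₂ l₃ l₄ l₅ #S := by
  simp only [evenVanishing, evenMoment, ← Nat.choose_eq_descFactorial_div_factorial,
    sum_add_distrib, sum_sub_distrib, ← mul_sum,
    ← h₁.sum_choose_card_inter S, ← h₂.sum_choose_card_inter S, ← h₃.sum_choose_card_inter S,
    ← h₄.sum_choose_card_inter S, ← h₅.sum_choose_card_inter S, Nat.cast_sum]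

end SelfDualDesign

namespace SelfDualDesign

/-! ### The dual code -/

section

variable {X : Type*} [Fintype X]

theorem dualCode_eq_orthogonal (C : Submodule (ZMod 2) (X → ZMod 2)) :
    dualCode C = LinearMap.BilinForm.orthogonal (dotProductBilin (ZMod 2) (ZMod 2)) C := by
  ext y
  rfl

theorem dotProductBilin_isRefl :
    LinearMap.BilinForm.IsRefl (dotProductBilin (m := X) (A := ZMod 2) (ZMod 2) (ZMod 2)) :=
  fun x y h => (dotProduct_comm y x).trans h

theorem dotProductBilin_nondegenerate :
    LinearMap.BilinForm.Nondegenerate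
      (dotProductBilin (m := X) (A := ZMod 2) (ZMod 2) (ZMod 2)) :=
  ⟨fun x h => dotProduct_eq_zero x h,
    fun x h => dotProduct_eq_zero x fun y => (dotProduct_comm x y).trans (h y)⟩

theorem dualCode_dualCode (C : Submodule (ZMod 2) (X → ZMod 2)) : dualCode (dualCode C) = C := by
  rw [dualCode_eq_orthogonal, dualCode_eq_orthogonal]
  exact LinearMap.BilinForm.orthogonal_orthogonal dotProductBilin_nondegenerate
    dotProductBilin_isRefl C

theorem finrank_dualCode (C : Submodule (ZMod 2) (X → ZMod 2)) :
    Module.finrank (ZMod 2) (dualCode C) = Fintype.card X - Module.finrank (ZMod 2) C := by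
  rw [dualCode_eq_orthogonal,
    LinearMap.BilinForm.finrank_orthogonal dotProductBilin_nondegenerate,
    Module.finrank_fintype_fun_eq_card]

/-- A self-orthogonal code that is not self-dual has dimension less than half its length. -/
theorem card_le_of_lt_dualCode {C : Submodule (ZMod 2) (X → ZMod 2)} {d : ℕ}
    (hcard : Fintype.card X = 2 * (d + 1)) (hC : C < dualCode C) : Nat.card C ≤ 2 ^ d := by
  have h := Submodule.finrank_lt_finrank_of_lt hC
  rw [finrank_dualCode] at h
  rw [Module.natCard_eq_pow_finrank (K := ZMod 2), Nat.card_zmod]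
  exact Nat.pow_le_pow_right two_pos (by omega)

end

variable {X : Type*} [Fintype X] [DecidableEq X]

/-- The characteristic vector of a point set. -/
def charVec (S : Finset X) : X → ZMod 2 := fun x => if x ∈ S then 1 else 0

/-- The support of a binary vector. -/
def supp (c : X → ZMod 2) : Finset X := {x | c x ≠ 0}

@[simp] theorem charVec_supp (c : X → ZMod 2) : charVec (supp c) = c := by
  ext x
  have : ∀ a : ZMod 2, (if a ≠ 0 then 1 else 0) = a := by decide
  simpa [charVec, supp] using this (c x)

@[simp] theorem supp_charVec (S : Finset X) : supp (charVec S) = S := by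
  ext x
  simp [charVec, supp]

theorem charVec_dotProduct_charVec (S T : Finset X) :
    charVec S ⬝ᵥ charVec T = (#(S ∩ T) : ZMod 2) := by
  simp [charVec, dotProduct, ← ite_and, ← mem_inter, inter_comm]

theorem dotProduct_eq_zero_iff (c d : X → ZMod 2) : c ⬝ᵥ d = 0 ↔ Even #(supp c ∩ supp d) := by
  rw [← ZMod.natCast_eq_zero_iff_even, ← charVec_dotProduct_charVec, charVec_supp, charVec_supp]

theorem card_supp_add (c d : X → ZMod 2) :
    #(supp (c + d)) + 2 * #(supp c ∩ supp d) = #(supp c) + #(supp d) := by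
  have h : supp (c + d) = symmDiff (supp c) (supp d) := by
    ext x
    have : ∀ a b : ZMod 2, a + b ≠ 0 ↔ a ≠ 0 ∧ ¬ b ≠ 0 ∨ b ≠ 0 ∧ ¬ a ≠ 0 := by decide
    simpa [supp, mem_symmDiff] using this (c x) (d x)
  have h1 := card_sdiff_add_card_inter (supp c) (supp d)
  have h2 := card_sdiff_add_card_inter (supp d) (supp c)
  rw [inter_comm] at h2
  rw [h, symmDiff_def, sup_eq_union, card_union_of_disjoint disjoint_sdiff_sdiff]
  omega

theorem card_supp_one_add (c : X → ZMod 2) :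
    #(supp (1 + c)) = Fintype.card X - #(supp c) := by
  rw [← card_compl]
  congr 1
  ext x
  have : ∀ a : ZMod 2, 1 + a ≠ 0 ↔ ¬ a ≠ 0 := by decide
  simpa [supp] using this (c x)

/-- Evenness of the dual says that the all-one word is in the double dual. -/
theorem one_mem_of_even {C : Submodule (ZMod 2) (X → ZMod 2)}
    (h : ∀ y ∈ dualCode C, Even #(supp y)) : 1 ∈ C := by
  rw [← dualCode_dualCode C]
  intro y hy
  rw [dotProduct_eq_zero_iff]
  simpa [supp] using h y hy

/-! ### The MacWilliams identity -/

/-- The value at `i` of the binary Krawtchouk polynomial of degree `j` for length `n`, with the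
binomial coefficients written so that it is computed quickly. -/
def krawtchouk (n j i : ℕ) : ℤ :=
  ∑ s ∈ range (j + 1), (-1) ^ s * ((i.descFactorial s / s.factorial *
    ((n - i).descFactorial (j - s) / (j - s).factorial) : ℕ) : ℤ)

/-- Both sides are the coefficient of z^j in (1 - z)^|A| (1 + z)^(n - |A|), expanded over subsets on
the left. -/
theorem sum_powersetCard_neg_one_pow (A : Finset X) (j : ℕ) :
    ∑ S ∈ powersetCard j univ, (-1 : ℤ) ^ #(A ∩ S) = krawtchouk (Fintype.card X) j #A := by
  have hprod : ∏ x : X, (1 + Polynomial.C (if x ∈ A then (-1 : ℤ) else 1) * Polynomial.X) =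
      (1 - Polynomial.X) ^ #A * (1 + Polynomial.X) ^ (Fintype.card X - #A) := by
    rw [← prod_mul_prod_compl A, ← card_compl]
    congr 1
    · refine prod_eq_pow_card fun x hx => ?_
      simp [hx, sub_eq_add_neg]
    · refine prod_eq_pow_card fun x hx => ?_
      simp [mem_compl.1 hx]
  have hsum : ∏ x : X, (1 + Polynomial.C (if x ∈ A then (-1 : ℤ) else 1) * Polynomial.X) =
      ∑ S : Finset X, Polynomial.C ((-1 : ℤ) ^ #(A ∩ S)) * Polynomial.X ^ #S := by
    rw [prod_one_add, powerset_univ]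
    refine sum_congr rfl fun S _ => ?_
    rw [prod_mul_distrib, prod_const, ← map_prod, prod_ite, prod_const_one, mul_one, prod_const,
      inter_comm, filter_mem_eq_inter]
  have hcoeff := congrArg (Polynomial.coeff · j) (hsum.symm.trans hprod)
  rw [Polynomial.finsetSum_coeff, Polynomial.coeff_mul] at hcoeff
  have hneg (m s : ℕ) : ((1 - Polynomial.X : Polynomial ℤ) ^ m).coeff s =
      (-1) ^ s * (m.choose s : ℤ) := by
    have : (1 - Polynomial.X : Polynomial ℤ) ^ m =
        ((1 + Polynomial.X) ^ m : Polynomial ℤ).comp (Polynomial.C (-1) * Polynomial.X) := by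
      simp [sub_eq_add_neg]
    rw [this, Polynomial.comp_C_mul_X_coeff, Polynomial.coeff_one_add_X_pow, mul_comm]
  rw [powersetCard_eq_filter, sum_filter, powerset_univ]
  simp only [hneg, Polynomial.coeff_one_add_X_pow, Polynomial.coeff_C_mul_X_pow,
    eq_comm (a := j)] at hcoeff
  rw [hcoeff, Nat.sum_antidiagonal_eq_sum_range_succ_mk, krawtchouk]
  refine sum_congr rfl fun s _ => ?_
  simp only [Nat.choose_eq_descFactorial_div_factorial]
  push_cast
  ring

/-- Orthogonality of characters: translating by a word `d` not orthogonal to `S` negates the sum. -/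
theorem sum_code_neg_one_pow (C : Submodule (ZMod 2) (X → ZMod 2)) (S : Finset X)
    [Decidable (charVec S ∈ dualCode C)] [Fintype C] :
    ∑ c : C, (-1 : ℤ) ^ #(supp c.1 ∩ S) =
      if charVec S ∈ dualCode C then (Fintype.card C : ℤ) else 0 := by
  split_ifs with hS
  · rw [sum_congr rfl fun c _ => Even.neg_one_pow ?_]
    · simp
    · have := hS c c.2
      rwa [dotProduct_eq_zero_iff, supp_charVec] at this
  · obtain ⟨d, hd, hdS⟩ : ∃ d ∈ C, ¬ d ⬝ᵥ charVec S = 0 := by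
      by_contra! h
      exact hS h
    have hflip (c : C) : (-1 : ℤ) ^ #(supp (c + ⟨d, hd⟩ : C).1 ∩ S) =
        -(-1 : ℤ) ^ #(supp c.1 ∩ S) := by
      have hadd : (c.1 + d) ⬝ᵥ charVec S = c.1 ⬝ᵥ charVec S + d ⬝ᵥ charVec S :=
        add_dotProduct _ _ _
      have h1 := dotProduct_eq_zero_iff (c.1 + d) (charVec S)
      have h2 := dotProduct_eq_zero_iff c.1 (charVec S)
      rw [supp_charVec] at h1 h2
      have hne : ∀ a b : ZMod 2, b ≠ 0 → (a + b = 0 ↔ ¬ a = 0) := by decide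
      have hiff : Even #(supp (c.1 + d) ∩ S) ↔ ¬ Even #(supp c.1 ∩ S) := by
        rw [← h1, ← h2, hadd, hne _ _ hdS]
      change (-1 : ℤ) ^ #(supp (c.1 + d) ∩ S) = _
      by_cases he : Even #(supp c.1 ∩ S)
      · rw [he.neg_one_pow, (Nat.not_even_iff_odd.1 (mt hiff.1 (not_not.2 he))).neg_one_pow]
      · rw [(Nat.not_even_iff_odd.1 he).neg_one_pow, (hiff.2 he).neg_one_pow, neg_neg]
    have h := Equiv.sum_comp (Equiv.addRight (⟨d, hd⟩ : C))
      fun c => (-1 : ℤ) ^ #(supp c.1 ∩ S)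
    simp only [Equiv.coe_addRight, hflip, sum_neg_distrib] at h
    linarith

open Classical in
/-- The MacWilliams identity, in terms of Krawtchouk polynomials. -/
theorem sum_krawtchouk (C : Submodule (ZMod 2) (X → ZMod 2)) [Fintype C] (j : ℕ) :
    ∑ c : C, krawtchouk (Fintype.card X) j #(supp c.1) =
      Fintype.card C * #{S ∈ powersetCard j (univ : Finset X) | charVec S ∈ dualCode C} := by
  simp only [← sum_powersetCard_neg_one_pow]
  rw [sum_comm]
  simp only [sum_code_neg_one_pow]
  rw [← sum_filter, sum_const, nsmul_eq_mul, mul_comm]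

end SelfDualDesign

/-! ### The linear programming bound. -/

namespace SelfDualDesign

/-- The polynomial with constant Krawtchouk coefficient `f₀` and the further Krawtchouk
coefficients listed in `L`, evaluated at `i`. -/
def krawtchoukSum (n : ℕ) (f₀ : ℤ) (L : List (ℕ × ℤ)) (i : ℕ) : ℤ :=
  f₀ + (L.map fun p => p.2 * krawtchouk n p.1 i).sum

/-- A linear programming certificate which excludes a doubly even self-orthogonal code of length
`n` with at most `2 ^ d` words that contains the all-one word and at least `b` words of weight `k`,
and whose dual has no words of weights `2`, `4`, `6`, `8`. -/
structure IsCertificate (n d k b : ℕ) (f₀ : ℤ) (L : List (ℕ × ℤ)) : Prop where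
  coeff_zero_nonneg : 0 ≤ f₀
  coeff_nonpos : ∀ p ∈ L, p.1 ∈ [2, 4, 6, 8] ∨ p.1 ≠ 0 ∧ p.2 ≤ 0
  weight : 0 < k ∧ k < n - k ∧ n - k < n
  value_nonneg : ∀ i ∈ range (n + 1), i % 4 = 0 → i ∉ [0, 4, 8, n - 8, n - 4, n] →
    0 ≤ krawtchoukSum n f₀ L i
  weight_nonneg : 0 ≤ krawtchoukSum n f₀ L k ∧ 0 ≤ krawtchoukSum n f₀ L (n - k)
  bound : 2 ^ d * f₀ < krawtchoukSum n f₀ L 0 + b * krawtchoukSum n f₀ L k +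
    b * krawtchoukSum n f₀ L (n - k) + krawtchoukSum n f₀ L n

variable {X : Type*} [Fintype X] [DecidableEq X]

theorem sum_krawtchoukSum_le {C : Submodule (ZMod 2) (X → ZMod 2)} [Fintype C] {d k b : ℕ} {f₀ : ℤ}
    {L : List (ℕ × ℤ)} (hcert : IsCertificate (Fintype.card X) d k b f₀ L)
    (hC : Fintype.card C ≤ 2 ^ d)
    (hmin : ∀ y ∈ dualCode C, #(supp y) ∉ [2, 4, 6, 8]) :
    ∑ c : C, krawtchoukSum (Fintype.card X) f₀ L #(supp c.1) ≤ 2 ^ d * f₀ := by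
  classical
  have hterm : ∀ p ∈ L, (∑ c : C, p.2 * krawtchouk (Fintype.card X) p.1 #(supp c.1)) ≤ 0 := by
    intro p hp
    rw [← mul_sum, sum_krawtchouk]
    rcases hcert.coeff_nonpos p hp with h | h
    · rw [filter_eq_empty_iff.2]
      · simp
      · intro S hS hSC
        refine hmin _ hSC ?_
        rwa [supp_charVec, (mem_powersetCard.1 hS).2]
    · exact mul_nonpos_of_nonpos_of_nonneg h.2 (by positivity)
  have hlist : ∀ M : List (ℕ × ℤ), M ⊆ L → (∑ c : C,
      (M.map fun p => p.2 * krawtchouk (Fintype.card X) p.1 #(supp c.1)).sum) ≤ 0 := by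
    intro M hM
    induction M with
    | nil => simp
    | cons p M ih =>
      simp only [List.map_cons, List.sum_cons, sum_add_distrib]
      have h1 := hterm p (hM List.mem_cons_self)
      have h2 := ih fun q hq => hM (List.mem_cons_of_mem _ hq)
      linarith
  have hcard : (Fintype.card C : ℤ) * f₀ ≤ 2 ^ d * f₀ :=
    mul_le_mul_of_nonneg_right (mod_cast hC) hcert.coeff_zero_nonneg
  have h := hlist L (List.Subset.refl L)
  simp only [krawtchoukSum, sum_add_distrib, sum_const, card_univ, nsmul_eq_mul]
  linarith

theorem le_sum_krawtchoukSum {C : Submodule (ZMod 2) (X → ZMod 2)} [Fintype C] {d k b : ℕ} {f₀ : ℤ}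
    {L : List (ℕ × ℤ)} (hcert : IsCertificate (Fintype.card X) d k b f₀ L)
    (hself : C ≤ dualCode C) (hone : 1 ∈ C) (hfour : ∀ c ∈ C, 4 ∣ #(supp c))
    (hmin : ∀ y ∈ dualCode C, #(supp y) ∉ [2, 4, 6, 8])
    (hb : b ≤ #{c : C | #(supp c.1) = k}) :
    2 ^ d * f₀ < ∑ c : C, krawtchoukSum (Fintype.card X) f₀ L #(supp c.1) := by
  set n := Fintype.card X with hn
  set F := krawtchoukSum n f₀ L with hF
  have hle (c : X → ZMod 2) : #(supp c) ≤ n := card_le_univ _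
  -- Adding the all-one word pairs weight i with weight n - i.
  have hcompl (i : ℕ) (hi : i ≤ n) :
      #{c : C | #(supp c.1) = i} = #{c : C | #(supp c.1) = n - i} := by
    refine card_equiv (Equiv.addLeft (⟨1, hone⟩ : C)) fun c => ?_
    have h1 := card_supp_one_add c.1
    have h2 := hle c.1
    simp only [mem_filter, mem_univ, true_and]
    change _ ↔ #(supp (1 + c.1)) = n - i
    omega
  have hzero : #{c : C | #(supp c.1) = 0} = 1 := by
    rw [card_eq_one]
    refine ⟨0, ?_⟩
    ext c
    simp only [mem_filter, mem_univ, true_and, mem_singleton, card_eq_zero]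
    constructor
    · intro h
      ext x
      have hc := charVec_supp c.1
      rw [h] at hc
      simpa [charVec] using congrFun hc.symm x
    · rintro rfl
      simp [supp]
  have htop : #{c : C | #(supp c.1) = n} = 1 := by
    have h := hcompl 0 n.zero_le
    rwa [hzero, Nat.sub_zero, eq_comm] at h
  obtain ⟨hk0, hk, hkn⟩ := hcert.weight
  have hb' : b ≤ #{c : C | #(supp c.1) = n - k} := hb.trans_eq (hcompl k (by omega))
  have hfib : ∑ c : C, F #(supp c.1) =
      ∑ i ∈ range (n + 1), (#{c : C | #(supp c.1) = i} : ℤ) * F i := by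
    rw [← sum_fiberwise_of_maps_to (t := range (n + 1)) (g := fun c : C => #(supp c.1))
      fun c _ => mem_range.2 (Nat.lt_succ_of_le (hle c.1))]
    refine sum_congr rfl fun i _ => ?_
    rw [sum_congr rfl fun c hc => by rw [(mem_filter.1 hc).2], sum_const, nsmul_eq_mul]
  have hsub : ∑ i ∈ ({0, k, n - k, n} : Finset ℕ), (#{c : C | #(supp c.1) = i} : ℤ) * F i ≤
      ∑ i ∈ range (n + 1), (#{c : C | #(supp c.1) = i} : ℤ) * F i := by
    refine sum_le_sum_of_subset_of_nonneg ?_ fun i hi hi' => ?_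
    · intro i hi
      simp only [mem_insert, mem_singleton] at hi
      rw [mem_range]
      omega
    rcases eq_empty_or_nonempty ({c : C | #(supp c.1) = i} : Finset C) with he | ⟨c, hc⟩
    · simp [he]
    refine mul_nonneg (Nat.cast_nonneg _) (hcert.value_nonneg i hi ?_ ?_)
    · have := hfour c c.2
      rw [(mem_filter.1 hc).2] at this
      omega
    -- Both `c` and its complement lie in the dual, so weights 4, 8, n - 8, n - 4 do not occur.
    · have h1 := hmin c (hself c.2)
      have h2 := hmin (1 + c) (hself (C.add_mem hone c.2))
      have h3 := card_supp_one_add c.1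
      have h4 := hle c.1
      rw [(mem_filter.1 hc).2] at h1 h3 h4
      simp only [mem_insert, mem_singleton, List.mem_cons, List.not_mem_nil, or_false]
        at hi' h1 h2 ⊢
      omega
  rw [sum_insert (by simp; omega), sum_insert (by simp; omega), sum_insert (by simp; omega),
    sum_singleton, hzero, htop] at hsub
  have h1 := mul_le_mul_of_nonneg_right (Int.ofNat_le.2 hb) hcert.weight_nonneg.1
  have h2 := mul_le_mul_of_nonneg_right (Int.ofNat_le.2 hb') hcert.weight_nonneg.2
  have h3 := hcert.bound
  rw [hfib]
  push_cast at h1 h2 hsub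
  linarith

/-- The linear programming bound for self-duality of a doubly even code. -/
theorem isSelfDual_of_certificate {C : Submodule (ZMod 2) (X → ZMod 2)} {d k b : ℕ} {f₀ : ℤ}
    {L : List (ℕ × ℤ)} (hcert : IsCertificate (Fintype.card X) d k b f₀ L)
    (hcard : Fintype.card X = 2 * (d + 1)) (hself : C ≤ dualCode C)
    (hfour : ∀ c ∈ C, 4 ∣ #(supp c)) (heven : ∀ y ∈ dualCode C, Even #(supp y))
    (hmin : ∀ y ∈ dualCode C, #(supp y) ∉ [2, 4, 6, 8])
    (hb : b ≤ Nat.card {c : C // #(supp c.1) = k}) : IsSelfDual C := by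
  classical
  by_contra hne
  have hC := card_le_of_lt_dualCode hcard (lt_of_le_of_ne hself hne)
  have : Fintype C := Fintype.ofFinite C
  rw [Nat.card_eq_fintype_card] at hC hb
  rw [Fintype.card_subtype] at hb
  exact absurd (sum_krawtchoukSum_le hcert hC hmin) (not_le.2
    (le_sum_krawtchoukSum hcert hself (one_mem_of_even heven) hfour hmin hb))

/-! ### The code of a self-orthogonal design -/

theorem charVec_mem_code {X : Type*} [DecidableEq X] {blocks : Finset (Finset X)} {b : Finset X}
    (hb : b ∈ blocks) : charVec b ∈ code blocks :=
  Submodule.subset_span ⟨⟨b, hb⟩, rfl⟩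

theorem even_card_inter_of_mem_dualCode {blocks : Finset (Finset X)} {y : X → ZMod 2}
    (hy : y ∈ dualCode (code blocks)) : ∀ b ∈ blocks, Even #(b ∩ supp y) := by
  intro b hb
  have h := hy _ (charVec_mem_code hb)
  rwa [dotProduct_eq_zero_iff, supp_charVec] at h

theorem code_le_dualCode {k : ℕ} {blocks : Finset (Finset X)} (hk : Even k)
    (hcard : ∀ b ∈ blocks, #b = k) (hso : IsSelfOrthogonal k blocks) :
    code blocks ≤ dualCode (code blocks) := by
  have hpair : ∀ b ∈ blocks, ∀ b' ∈ blocks, charVec b ⬝ᵥ charVec b' = 0 := by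
    intro b hb b' hb'
    rw [dotProduct_eq_zero_iff, supp_charVec, supp_charVec]
    rcases eq_or_ne b b' with rfl | hne
    · rwa [inter_self, hcard b hb]
    · exact Nat.even_iff.2 (Eq.trans (hso b hb b' hb' hne) (Nat.even_iff.1 hk))
  refine Submodule.span_le.2 ?_
  rintro _ ⟨b', rfl⟩ x hx
  induction hx using Submodule.span_induction with
  | mem x hx =>
    obtain ⟨b, rfl⟩ := hx
    exact hpair b b.2 b' b'.2
  | zero => exact zero_dotProduct _
  | add x y _ _ hx hy => rw [add_dotProduct, hx, hy, add_zero]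
  | smul a x _ hx => rw [smul_dotProduct, hx, smul_zero]

/-- |x + y| = |x| + |y| - 2|x ∩ y|, and the overlap is even by self-orthogonality. -/
theorem four_dvd_card_supp {k : ℕ} {blocks : Finset (Finset X)} (hk : 4 ∣ k)
    (hcard : ∀ b ∈ blocks, #b = k) (hself : code blocks ≤ dualCode (code blocks)) :
    ∀ c ∈ code blocks, 4 ∣ #(supp c) := by
  intro c hc
  induction hc using Submodule.span_induction with
  | mem x hx =>
    obtain ⟨b, rfl⟩ := hx
    change 4 ∣ #(supp (charVec b.1))
    rwa [supp_charVec, hcard b b.2]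
  | zero => simp [supp]
  | add x y hx hy hx4 hy4 =>
    have h1 := card_supp_add x y
    have h2 := (dotProduct_eq_zero_iff x y).1 (hself hy x hx)
    obtain ⟨m, hm⟩ := h2.two_dvd
    omega
  | smul a x _ hx =>
    obtain rfl | rfl : a = 0 ∨ a = 1 := by revert a; decide
    · simp [supp]
    · rwa [one_smul]

theorem card_blocks_le {k : ℕ} {blocks : Finset (Finset X)} (hcard : ∀ b ∈ blocks, #b = k) :
    #blocks ≤ Nat.card {c : code blocks // #(supp c.1) = k} := by
  rw [← Nat.card_eq_finsetCard]
  refine Nat.card_le_card_of_injective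
    (fun b : blocks => ⟨⟨charVec b.1, charVec_mem_code b.2⟩, ?_⟩) ?_
  · rw [supp_charVec, hcard b b.2]
  · intro b b' h
    have h' : charVec b.1 = charVec b'.1 := congrArg (fun c => c.1.1) h
    ext1
    rw [← supp_charVec b.1, h', supp_charVec]

/-- The code of a self-orthogonal `5`-design is self-dual if its numbers of blocks
through `0, …, 5` points satisfy the given arithmetic conditions and there is a linear programming certificate. -/
theorem isSelfDual_code {v d k l₀ l₁ l₂ l₃ l₄ l₅ : ℕ} {f₀ : ℤ} {L : List (ℕ × ℤ)}
    {blocks : Finset (Finset X)} (h₅ : IsDesign X 5 v k l₅ blocks)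
    (hso : IsSelfOrthogonal k blocks) (hv : v = 2 * (d + 1)) (hk : 4 ∣ k) (hk5 : 5 ≤ k)
    (h₄₅ : l₅ * (v - 4) = l₄ * (k - 4)) (h₃₄ : l₄ * (v - 3) = l₃ * (k - 3))
    (h₂₃ : l₃ * (v - 2) = l₂ * (k - 2)) (h₁₂ : l₂ * (v - 1) = l₁ * (k - 1))
    (h₀₁ : l₁ * v = l₀ * k)
    (hodd : ∀ w ∈ range (v + 1), w % 2 = 1 → evenMoment l₁ l₂ l₃ l₄ l₅ w % 3840 ≠ 0)
    (hsmall : ∀ w ∈ [2, 4, 6, 8], evenMoment l₁ l₂ l₃ l₄ l₅ w ≠ 0)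
    (hcert : IsCertificate v d k l₀ f₀ L) : IsSelfDual (code blocks) := by
  have h₄ := h₅.of_succ (by omega) h₄₅
  have h₃ := h₄.of_succ (by omega) h₃₄
  have h₂ := h₃.of_succ (by omega) h₂₃
  have h₁ := h₂.of_succ (by omega) h₁₂
  have h₀ := h₁.of_succ (by omega) h₀₁
  have hX := h₅.card_points
  have hself := code_le_dualCode ((even_iff_two_dvd).2 (by omega)) h₅.card_block hso
  have hblocks : #blocks = l₀ := by simpa using h₀.sum_choose_card_inter ∅
  have hmoment := sum_evenVanishing h₁ h₂ h₃ h₄ h₅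
  refine isSelfDual_of_certificate (b := l₀) (by rwa [hX]) (hX.trans hv) hself
    (four_dvd_card_supp hk h₅.card_block hself) (fun y hy => ?_) (fun y hy => ?_)
    (hblocks ▸ card_blocks_le h₅.card_block)
  · by_contra hy2
    refine hodd #(supp y) ?_ (Nat.odd_iff.1 (Nat.not_even_iff_odd.1 hy2)) ?_
    · exact mem_range.2 (Nat.lt_succ_of_le (hX ▸ card_le_univ _))
    · rw [← hmoment]
      exact Int.emod_eq_zero_of_dvd (dvd_sum_evenVanishing (even_card_inter_of_mem_dualCode hy))
  · intro hw
    refine hsmall _ hw ?_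
    rw [← hmoment]
    refine sum_evenVanishing_eq_zero (even_card_inter_of_mem_dualCode hy) ?_
    simp only [List.mem_cons, List.not_mem_nil, or_false] at hw
    omega

end SelfDualDesign

/-! ### Numerical certificates and the five parameter sets. -/

namespace SelfDualDesign

theorem isCertificate_120_36 : IsCertificate 120 59 36 18824510698240
    16997863411591349330799950959555572600 [
      (2, 3706194898942782644376038072485409391), (4, 379020390633153825740763245528643712),
      (6, 54235107593291986187364311526246417), (8, 3323895862922452136335221189702256),
      (18, -453677055391642632106105395), (28, -47666134788107032156293152),
      (30, -1485005134412756406383940), (32, -1837205290107916041617768),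
      (34, -2028703916907113619041847)] where
  coeff_zero_nonneg := by decide +kernel
  coeff_nonpos := by decide +kernel
  weight := by decide +kernel
  value_nonneg := by decide +kernel
  weight_nonneg := by decide +kernel
  bound := by decide +kernel

theorem isCertificate_120_40 : IsCertificate 120 59 40 397450513031544
    5053956161667810897789475995010280688 [
      (2, 602765802255896388860568716882018304), (4, 58694490529294190160969554859876830),
      (6, 3904587675611888169380153125306368), (8, 156185625536626147010291733379808),
      (12, -180636502168103723547158481822), (20, -40627091524071351193365978),
      (28, -64899575503717306808365), (30, -273071214349280339066880),
      (32, -111073166034958938530512)] where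
  coeff_zero_nonneg := by decide +kernel
  coeff_nonpos := by decide +kernel
  weight := by decide +kernel
  value_nonneg := by decide +kernel
  weight_nonneg := by decide +kernel
  bound := by decide +kernel

theorem isCertificate_120_44 : IsCertificate 120 59 44 4630512364732800
    551935260 [
      (2, 49092951), (4, 3285712), (6, 142467), (8, 2476), (10, -45)] where
  coeff_zero_nonneg := by decide +kernel
  coeff_nonpos := by decide +kernel
  weight := by decide +kernel
  value_nonneg := by decide +kernel
  weight_nonneg := by decide +kernel
  bound := by decide +kernel

theorem isCertificate_120_48 : IsCertificate 120 59 48 30531599026535880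
    339687961886827263595931826921250910612721090 [
      (2, 12395852815139195258522492135724091400929296),
      (4, 160170292933430010263611103322301715127049),
      (6, 18903142539492351280842598047108264041952),
      (8, 3185572914141784589075035851521457375748), (20, -4941765527747738253827700347550675),
      (28, -57266912298199320927217207821530), (30, -33131976602657206145195820678240),
      (32, -13851501613689701704781252739878), (34, -2297989837356665201438926928112)] where
  coeff_zero_nonneg := by decide +kernel
  coeff_nonpos := by decide +kernel
  weight := by decide +kernel
  value_nonneg := by decide +kernel
  weight_nonneg := by decide +kernel
  bound := by decide +kernel

theorem isCertificate_144_56 : IsCertificate 144 71 56 35648745873701148864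
    23527906418791706909203134504483889241394427849878252911889193478721373751424 [
      (2, 549612986865388117943341505831601788859676527833278615641240694363031322624),
      (4, 102834728635229785253442413669550022204674889575624496589315772555429270984),
      (6, -3752246077652889204905364780823686474370418632312181999253474064791452160),
      (8, 866269155167091721910311885312579576035494234504371130465538518989659360),
      (22, -9014547789059341748300683919505277365112354519164092111773536000),
      (28, -108268167129027420298876972921956167958579448477767327221125500),
      (32, -15583871472944540839168016077815673536339775682281690331748000),
      (36, -8709009710160822172871043229678141092329011971450637766491035),
      (38, -2416510202121805108248326520849665354153450834927738187455040),
      (40, -2840226230063711665269983039472917952956464690280498334700424),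
      (42, -266918723808395936520001057639478362595907338638924268403264),
      (44, -299354296591880938099815544993994775274252645389440867869739)] where
  coeff_zero_nonneg := by decide +kernel
  coeff_nonpos := by decide +kernel
  weight := by decide +kernel
  value_nonneg := by decide +kernel
  weight_nonneg := by decide +kernel
  bound := by decide +kernel

end SelfDualDesign

theorem proposition3p2 {X : Type*} [Fintype X] [DecidableEq X] (v k lam : ℕ)
    (hpar : (v, k, lam) ∈ ({(120, 36, 37237713920), (120, 40, 1372275835848),
      (120, 44, 26386953577600), (120, 48, 274320081834480),
      (144, 56, 283096123959568608)} : Set (ℕ × ℕ × ℕ)))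
    (blocks : Finset (Finset X)) (hdesign : SelfDualDesign.IsDesign X 5 v k lam blocks)
    (hso : SelfDualDesign.IsSelfOrthogonal k blocks) :
    SelfDualDesign.IsSelfDual (SelfDualDesign.code blocks) := by
  simp only [Set.mem_insert_iff, Set.mem_singleton_iff, Prod.mk.injEq] at hpar
  rcases hpar with ⟨rfl, rfl, rfl⟩ | ⟨rfl, rfl, rfl⟩ | ⟨rfl, rfl, rfl⟩ | ⟨rfl, rfl, rfl⟩ |
    ⟨rfl, rfl, rfl⟩
  -- The `lᵢ` are forced by l_{i+1} (v - i) = l_i (k - i); `l₀` and `d` are read off the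
  -- certificate.
  · exact SelfDualDesign.isSelfDual_code (l₄ := 134986712960) (l₃ := 478589255040)
      (l₂ := 1660986238080) (l₁ := 5647353209472) hdesign hso (by norm_num)
      (by norm_num) (by norm_num) (by norm_num) (by norm_num) (by norm_num) (by norm_num)
      (by norm_num) (by decide +kernel) (by decide +kernel) SelfDualDesign.isCertificate_120_36
  · exact SelfDualDesign.isSelfDual_code (l₄ := 4421777693288) (l₃ := 13982378111208)
      (l₂ := 43418963608488) (l₁ := 132483504343848) hdesign hso (by norm_num)
      (by norm_num) (by norm_num) (by norm_num) (by norm_num) (by norm_num) (by norm_num)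
      (by norm_num) (by decide +kernel) (by decide +kernel) SelfDualDesign.isCertificate_120_40
  · exact SelfDualDesign.isSelfDual_code (l₄ := 76522165375040) (l₃ := 218368130460480)
      (l₂ := 613510461769920) (l₁ := 1697854533735360) hdesign hso (by norm_num)
      (by norm_num) (by norm_num) (by norm_num) (by norm_num) (by norm_num) (by norm_num)
      (by norm_num) (by decide +kernel) (by decide +kernel) SelfDualDesign.isCertificate_120_44
  · exact SelfDualDesign.isSelfDual_code (l₄ := 723207488472720) (l₃ := 1880339470029072)
      (l₂ := 4823479510074576) (l₁ := 12212639610614352) hdesign hso (by norm_num)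
      (by norm_num) (by norm_num) (by norm_num) (by norm_num) (by norm_num) (by norm_num)
      (by norm_num) (by decide +kernel) (by decide +kernel) SelfDualDesign.isCertificate_120_48
  · exact SelfDualDesign.isSelfDual_code (l₄ := 762181872198838560) (l₃ := 2027691395849740320)
      (l₂ := 5332077374271539360) (l₁ := 13863401173106002336) hdesign hso (by norm_num)
      (by norm_num) (by norm_num) (by norm_num) (by norm_num) (by norm_num) (by norm_num)
      (by norm_num) (by decide +kernel) (by decide +kernel) SelfDualDesign.isCertificate_144_56
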